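/- Graphs here may have multiple edges and self-loops: a graph $G$ consists of a set $V_G$ of vertices, a set $E^{\mathrm{dir}}_G$ of directed edges, maps $t_G,h_G\colon E^{\mathrm{dir}}_G\to V_G$ (tail and head), and an involution $\iota_G$ of $E^{\mathrm{dir}}_G$ with $t_G\iota_G=h_G$ (an edge with $\iota_G e=e$ is a half-loop). The degree of a vertex is the number of directed edges whose tail it is. A morphism of graphs is a pair of maps on vertices and directed edges that respects tails, heads and involutions; it is étale (respectively, covering) if for each vertex $v$ it maps the directed edges with tail $v$ injectively (respectively, bijectively) to those whose tail is the image of $v$, and likewise for heads. For a graph $B$, a $B$-graph is a graph $G$ with a morphism $G\to B$; it is called étale or covering if this morphism is. For a finite graph $\psi$, let $H_\psi$ be its Hashimoto (non-backtracking) matrix, indexed by $E^{\mathrm{dir}}_\psi$, whose $(e_1,e_2)$ entry is $1$ if $h_\psi(e_1)=t_\psi(e_2)$ and $\iota_\psi e_1\ne e_2$, and $0$ otherwise, and let $\mu_1(\psi)$ be the Perron-Frobenius eigenvalue of $H_\psi$, i.e., its spectral radius. For a connected étale $B$-graph $\psi\to B$, let $T=\mathrm{Tree}_{/B}(\psi)$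 be the universal cover of $B$-graphs extending $\psi$: the covering $B$-graph $T$, containing $\psi$, that is obtained from $\psi$ by adding at each vertex $v$ a new edge, ending in its own new vertex, for each directed edge of $B$ with tail the image of $v$ that is not the image of an edge with tail $v$, and then repeating this at the new vertices indefinitely. (If $G$ is a covering $B$-graph containing $\psi$, there is a unique morphism $T\to G$ of $B$-graphs that fixes $\psi$.) **Lemma.** Let $d\ge 3$ be an integer, let $B$ be a $d$-regular graph, and let $\psi$ be a finite, connected, étale $B$-graph with $\mu_1(\psi)>(d-1)^{1/2}$. Let $T=\mathrm{Tree}_{/B}(\psi)$. Then the adjacency matrix $A_T$ of $T$, whose $(v,w)$ entry is the number of directed edges from $v$ to $w$, defines a bounded operator on $L^2(V_T)$ (each vertex having measure $1$), and its operator norm is $$\|A_T\| = \mu_1(\psi)+\frac{d-1}{\mu_1(\psi)}.$$ -/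

import Mathlib

universe u₁ v₁ u₂ v₂ u₃ v₃

/-- A graph in which multiple edges, whole-loops and half-loops are allowed: vertices, directed
edges with tails and heads, and an involution `inv` on the directed edges that exchanges tails and
heads.  A half-loop is a directed edge fixed by `inv`. -/
structure InvGraph where
  V : Type u₁
  E : Type v₁
  t : E → V
  h : E → V
  inv : E → E
  inv_inv : ∀ e, inv (inv e) = e
  t_inv : ∀ e, t (inv e) = h e

namespace InvGraph

theorem h_inv (G : InvGraph.{u₁, v₁}) (e : G.E) : G.h (G.inv e) = G.t e := by
  rw [← G.t_inv, G.inv_inv]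

/-- Every vertex is the tail of exactly `d` directed edges; a whole-loop counts twice, a half-loop
once. -/
def IsRegular (G : InvGraph.{u₁, v₁}) (d : ℕ) : Prop :=
  ∀ v : G.V, Nat.card {e : G.E // G.t e = v} = d

/-- Nonempty, and any two vertices are joined by a walk. -/
def IsConnected (G : InvGraph.{u₁, v₁}) : Prop :=
  Nonempty G.V ∧
    ∀ v w : G.V, Relation.ReflTransGen (fun a b => ∃ e : G.E, G.t e = a ∧ G.h e = b) v w

/-- Morphisms of graphs.  A `B`-graph is a graph `G` together with a morphism `G.Hom B`. -/
@[ext]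
structure Hom (G : InvGraph.{u₁, v₁}) (H : InvGraph.{u₂, v₂}) where
  onV : G.V → H.V
  onE : G.E → H.E
  map_t : ∀ e, H.t (onE e) = onV (G.t e)
  map_h : ∀ e, H.h (onE e) = onV (G.h e)
  map_inv : ∀ e, onE (G.inv e) = H.inv (onE e)

namespace Hom

def comp {G : InvGraph.{u₁, v₁}} {H : InvGraph.{u₂, v₂}} {K : InvGraph.{u₃, v₃}}
    (g : H.Hom K) (f : G.Hom H) : G.Hom K where
  onV x := g.onV (f.onV x)
  onE e := g.onE (f.onE e)
  map_t e := by rw [g.map_t, f.map_t]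
  map_h e := by rw [g.map_h, f.map_h]
  map_inv e := by rw [f.map_inv, g.map_inv]

/-- Injective on the directed edges with a given head, and on those with a given tail. -/
def IsEtale {G : InvGraph.{u₁, v₁}} {H : InvGraph.{u₂, v₂}} (f : G.Hom H) : Prop :=
  ∀ v : G.V, Set.InjOn f.onE {e | G.h e = v} ∧ Set.InjOn f.onE {e | G.t e = v}

/-- Bijective from the directed edges with a given head `v` to those with head `f v`, and the same
for tails. -/
def IsCovering {G : InvGraph.{u₁, v₁}} {H : InvGraph.{u₂, v₂}} (f : G.Hom H) : Prop :=
  ∀ v : G.V, Set.BijOn f.onE {e | G.h e = v} {e | H.h e = f.onV v} ∧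
    Set.BijOn f.onE {e | G.t e = v} {e | H.t e = f.onV v}

end Hom

/-! ### The Hashimoto matrix -/

open Classical in
/-- The Hashimoto (non-backtracking) matrix: the `(e₁, e₂)` entry is `1` if `e₁, e₂` form a
non-backtracking walk, and `0` otherwise. -/
noncomputable def hashimoto (G : InvGraph.{u₁, v₁}) : Matrix G.E G.E ℂ :=
  Matrix.of fun e₁ e₂ => if G.h e₁ = G.t e₂ ∧ G.inv e₁ ≠ e₂ then 1 else 0

/-- The Perron-Frobenius eigenvalue of the (non-negative) Hashimoto matrix of a finite graph, i.e.,
the largest absolute value of a complex eigenvalue of that matrix. -/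
noncomputable def mu₁ (G : InvGraph.{u₁, v₁}) [Fintype G.E] [DecidableEq G.E] : ℝ :=
  (spectralRadius ℂ G.hashimoto).toReal

/-! ### The adjacency operator on `L²` -/

/-- The `(v, w)` entry of the adjacency matrix: the number of directed edges from `v` to `w`. -/
noncomputable def adj (G : InvGraph.{u₁, v₁}) (v w : G.V) : ℕ :=
  Nat.card {e : G.E // G.t e = v ∧ G.h e = w}

/-- The bounded operator `A` on `L²(V_G)` is given by the adjacency matrix of `G`. -/
def IsAdjacencyOperator (G : InvGraph.{u₁, v₁})
    (A : lp (fun _ : G.V => ℝ) 2 →L[ℝ] lp (fun _ : G.V => ℝ) 2) : Prop :=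
  ∀ (f : lp (fun _ : G.V => ℝ) 2) (v : G.V),
    HasSum (fun w : G.V => (G.adj v w : ℝ) * f w) (A f v)

/-! ### The relative tree -/

section RelTree

variable {B : InvGraph.{u₂, v₂}} {ψ : InvGraph.{u₁, v₁}} (π : ψ.Hom B)

/-- The new vertices of the relative tree, indexed by the edge of `B` below the new edge that leads
to the new vertex.  `start` adds a new edge and a new vertex at a vertex `v` of `ψ`, for each
directed edge of `B` leaving `π v` that is not the image of an edge of `ψ` leaving `v`; `step` does
the same at a previously created leaf, where the only edge of `B` that is already covered is the
reverse of the one that leads to the leaf. -/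
inductive Branch : B.E → Type (max u₁ v₂)
  | start (v : ψ.V) (e : B.E) (he : B.t e = π.onV v)
      (hnew : ∀ e' : ψ.E, ψ.t e' = v → π.onE e' ≠ e) : Branch e
  | step {e : B.E} (w : Branch e) (e' : B.E) (he' : B.t e' = B.h e) (hne : e' ≠ B.inv e) :
      Branch e'

/-- The vertices of the relative tree: those of `ψ`, and the new ones. -/
abbrev TreeVertex : Type (max u₁ v₂) := ψ.V ⊕ (Σ e : B.E, Branch π e)

/-- The vertex to which the new vertex was attached. -/
def Branch.parent : {e : B.E} → Branch π e → TreeVertex π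
  | _, .start v _ _ _ => Sum.inl v
  | _, .step w _ _ _ => Sum.inr ⟨_, w⟩

/-- The vertex map of the structure morphism of the relative tree. -/
def treeProjV : TreeVertex π → B.V
  | .inl v => π.onV v
  | .inr w => B.h w.1

/-- The relative tree `Tree_{/B}(ψ)`.  Its directed edges are those of `ψ` and, for each new vertex
`w`, an edge `(w, true)` from the parent of `w` to `w` and its inverse `(w, false)`. -/
def relTree : InvGraph.{max u₁ v₂, max u₁ v₁ v₂} where
  V := TreeVertex π
  E := ψ.E ⊕ ((Σ e : B.E, Branch π e) × Bool)
  t := fun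
    | .inl e => .inl (ψ.t e)
    | .inr (w, true) => w.2.parent
    | .inr (w, false) => .inr w
  h := fun
    | .inl e => .inl (ψ.h e)
    | .inr (w, true) => .inr w
    | .inr (w, false) => w.2.parent
  inv := fun
    | .inl e => .inl (ψ.inv e)
    | .inr (w, b) => .inr (w, !b)
  inv_inv := by
    rintro (e | ⟨w, b⟩)
    · simp [ψ.inv_inv]
    · simp
  t_inv := by
    rintro (e | ⟨w, _ | _⟩)
    · simp [ψ.t_inv]
    · rfl
    · rfl

theorem treeProjV_parent {e : B.E} (w : Branch π e) : treeProjV π w.parent = B.t e := by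
  cases w with
  | start v _ he _ => exact he.symm
  | step w _ he' _ => exact he'.symm

/-- The `B`-graph structure of the relative tree. -/
def treeProj : (relTree π).Hom B where
  onV := treeProjV π
  onE := fun
    | .inl e => π.onE e
    | .inr (w, true) => w.1
    | .inr (w, false) => B.inv w.1
  map_t := by
    rintro (e | ⟨w, _ | _⟩)
    · exact π.map_t e
    · exact B.t_inv w.1
    · exact (treeProjV_parent π w.2).symm
  map_h := by
    rintro (e | ⟨w, _ | _⟩)
    · exact π.map_h e
    · exact (B.h_inv w.1).trans (treeProjV_parent π w.2).symm
    · rfl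
  map_inv := by
    rintro (e | ⟨w, _ | _⟩)
    · exact π.map_inv e
    · exact (B.inv_inv w.1).symm
    · rfl

/-- The inclusion of `ψ` in the relative tree. -/
def treeIncl : ψ.Hom (relTree π) where
  onV := Sum.inl
  onE := Sum.inl
  map_t _ := rfl
  map_h _ := rfl
  map_inv _ := rfl

/-- If `π` is étale, then the relative tree is a covering `B`-graph. -/
theorem treeProj_isCovering (hπ : π.IsEtale) : (treeProj π).IsCovering := by
  have key : ∀ x : (relTree π).V, Set.BijOn (treeProj π).onE {e | (relTree π).t e = x}
      {e | B.t e = (treeProj π).onV x} := by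
    intro x
    refine ⟨?_, ?_, ?_⟩
    · intro e he
      have h1 := (treeProj π).map_t e
      rw [show (relTree π).t e = x from he] at h1
      exact h1
    · rintro e he f hf hef
      rcases e with e | ⟨⟨e, w⟩, _ | _⟩ <;> rcases f with f | ⟨⟨f, y⟩, _ | _⟩
      · have he' : (Sum.inl (ψ.t e) : TreeVertex π) = x := he
        have hf' : (Sum.inl (ψ.t f) : TreeVertex π) = x := hf
        have h1 : ψ.t e = ψ.t f := Sum.inl.inj (he'.trans hf'.symm)
        exact congrArg _ ((hπ (ψ.t f)).2 h1 rfl hef)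
      · exact absurd (he.trans (Eq.symm hf)) (by simp [relTree])
      · have h1 : (Sum.inl (ψ.t e) : TreeVertex π) = y.parent := he.trans (Eq.symm hf)
        cases y with
        | start v _ he' hnew => exact absurd hef (hnew e (Sum.inl.inj h1))
        | step y' _ he' hne => exact absurd h1 (by simp [Branch.parent])
      · exact absurd (he.trans (Eq.symm hf)) (by simp [relTree])
      · have h1 : (Sum.inr ⟨e, w⟩ : TreeVertex π) = Sum.inr ⟨f, y⟩ := he.trans (Eq.symm hf)
        rw [Sum.inr.inj h1]
      · have h1 : (Sum.inr ⟨e, w⟩ : TreeVertex π) = y.parent := he.trans (Eq.symm hf)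
        have h2 : B.inv e = f := hef
        cases y with
        | start v _ he' hnew => exact absurd h1 (by simp [Branch.parent])
        | step y' _ he' hne =>
          have h3 := congrArg Sigma.fst (Sum.inr.inj h1)
          exact absurd (by rw [← h2]; exact congrArg _ h3) hne
      · have h1 : w.parent = (Sum.inl (ψ.t f) : TreeVertex π) := he.trans (Eq.symm hf)
        cases w with
        | start v _ he' hnew => exact absurd hef.symm (hnew f (Sum.inl.inj h1.symm))
        | step y' _ he' hne => exact absurd h1 (by simp [Branch.parent])
      · have h1 : w.parent = (Sum.inr ⟨f, y⟩ : TreeVertex π) := he.trans (Eq.symm hf)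
        have h2 : e = B.inv f := hef
        cases w with
        | start v _ he' hnew => exact absurd h1 (by simp [Branch.parent])
        | step y' _ he' hne =>
          have h3 := congrArg Sigma.fst (Sum.inr.inj h1)
          exact absurd (by rw [h2]; exact congrArg _ h3.symm) hne
      · have h1 : w.parent = y.parent := he.trans (Eq.symm hf)
        have h2 : e = f := hef
        subst h2
        suffices w = y by rw [this]
        cases w with
        | start v _ he' hnew =>
          cases y with
          | start v' _ hf' hnew' =>
            obtain rfl : v = v' := Sum.inl.inj h1
            rfl
          | step y' _ he' hne => exact absurd h1 (by simp [Branch.parent])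
        | step w' _ he' hne =>
          cases y with
          | start v' _ hf' hnew' => exact absurd h1 (by simp [Branch.parent])
          | step y' _ he' hne =>
            have h3 := Sum.inr.inj h1
            cases h3
            rfl
    · intro e he
      rcases x with v | ⟨f, w⟩
      · by_cases hex : ∃ e' : ψ.E, ψ.t e' = v ∧ π.onE e' = e
        · obtain ⟨e', h1, h2⟩ := hex
          exact ⟨Sum.inl e', congrArg Sum.inl h1, h2⟩
        · exact ⟨Sum.inr (⟨e, .start v e he fun e' h1 h2 => hex ⟨e', h1, h2⟩⟩, true), rfl, rfl⟩
      · by_cases hex : e = B.inv f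
        · exact ⟨Sum.inr (⟨f, w⟩, false), rfl, hex.symm⟩
        · exact ⟨Sum.inr (⟨e, .step w e he hex⟩, true), rfl, rfl⟩
  intro x
  refine ⟨⟨?_, ?_, ?_⟩, key x⟩
  · intro e he
    have h1 := (treeProj π).map_h e
    rw [show (relTree π).h e = x from he] at h1
    exact h1
  · intro e he f hf hef
    have h1 : (relTree π).inv e = (relTree π).inv f :=
      (key x).2.1 (((relTree π).t_inv e).trans he) (((relTree π).t_inv f).trans hf)
        (by rw [(treeProj π).map_inv, (treeProj π).map_inv, hef])
    rw [← (relTree π).inv_inv e, h1, (relTree π).inv_inv]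
  · intro e he
    obtain ⟨f, hf, hfe⟩ := (key x).2.2 (show B.inv e ∈ _ from (B.t_inv e).trans he)
    exact ⟨(relTree π).inv f, ((relTree π).h_inv f).trans hf, by
      rw [(treeProj π).map_inv, hfe, B.inv_inv]⟩

variable {π} {G : InvGraph.{u₃, v₃}} {γ : G.Hom B}

theorem Hom.IsCovering.exists_lift (hγ : γ.IsCovering) (x : G.V) (e : B.E)
    (he : B.t e = γ.onV x) : ∃ e' : G.E, G.t e' = x ∧ γ.onE e' = e :=
  (hγ x).2.2.2 he

theorem Hom.IsCovering.lift_unique (hγ : γ.IsCovering) {e f : G.E} (ht : G.t e = G.t f)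
    (h : γ.onE e = γ.onE f) : e = f :=
  (hγ (G.t f)).2.2.1 ht rfl h

/-- The edge of the covering `G` that the last edge of a branch has to be mapped to. -/
noncomputable def liftBranch (hγ : γ.IsCovering) {j : ψ.Hom G} (hj : γ.comp j = π) :
    {e : B.E} → Branch π e → {e' : G.E // γ.onE e' = e}
  | _, .start v e he _ =>
    have hx := hγ.exists_lift (j.onV v) e (by rw [he, ← hj]; rfl)
    ⟨hx.choose, hx.choose_spec.2⟩
  | _, .step w e' he' _ =>
    have hx := hγ.exists_lift (G.h (liftBranch hγ hj w).1) e'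
      (by rw [he', ← γ.map_h, (liftBranch hγ hj w).2])
    ⟨hx.choose, hx.choose_spec.2⟩

/-- The vertex map of the morphism from the relative tree to a covering `G`. -/
noncomputable def liftV (hγ : γ.IsCovering) {j : ψ.Hom G} (hj : γ.comp j = π) :
    TreeVertex π → G.V
  | .inl v => j.onV v
  | .inr w => G.h (liftBranch hγ hj w.2).1

theorem t_liftBranch (hγ : γ.IsCovering) {j : ψ.Hom G} (hj : γ.comp j = π) {e : B.E}
    (w : Branch π e) : G.t (liftBranch hγ hj w).1 = liftV hγ hj w.parent := by
  cases w with
  | start v _ he _ =>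
    rw [liftBranch]
    exact (hγ.exists_lift (j.onV v) e (by rw [he, ← hj]; rfl)).choose_spec.1
  | step w _ he' _ =>
    rw [liftBranch]
    exact (hγ.exists_lift (G.h (liftBranch hγ hj w).1) e
      (by rw [he', ← γ.map_h, (liftBranch hγ hj w).2])).choose_spec.1

/-- The morphism from the relative tree to a covering `G`. -/
noncomputable def treeLift (hγ : γ.IsCovering) {j : ψ.Hom G} (hj : γ.comp j = π) :
    (relTree π).Hom G where
  onV := liftV hγ hj
  onE := fun
    | .inl e => j.onE e
    | .inr (w, true) => (liftBranch hγ hj w.2).1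
    | .inr (w, false) => G.inv (liftBranch hγ hj w.2).1
  map_t := by
    rintro (e | ⟨w, _ | _⟩)
    · exact j.map_t e
    · exact G.t_inv _
    · exact t_liftBranch hγ hj w.2
  map_h := by
    rintro (e | ⟨w, _ | _⟩)
    · exact j.map_h e
    · exact (G.h_inv _).trans (t_liftBranch hγ hj w.2)
    · rfl
  map_inv := by
    rintro (e | ⟨w, _ | _⟩)
    · exact j.map_inv e
    · exact (G.inv_inv _).symm
    · rfl

theorem treeLift_unique_aux (hγ : γ.IsCovering) {j : ψ.Hom G} {F F' : (relTree π).Hom G}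
    (hF : γ.comp F = treeProj π) (hF' : γ.comp F' = treeProj π)
    (hj : F.comp (treeIncl π) = j) (hj' : F'.comp (treeIncl π) = j) {e : B.E}
    (w : Branch π e) : F.onE (Sum.inr (⟨e, w⟩, true)) = F'.onE (Sum.inr (⟨e, w⟩, true)) := by
  have hE : ∀ x, γ.onE (F.onE x) = γ.onE (F'.onE x) := fun x =>
    congrFun (congrArg Hom.onE (hF.trans hF'.symm)) x
  induction w with
  | start v e he hnew =>
    refine hγ.lift_unique ?_ (hE _)
    have h1 : F.onV (Sum.inl v) = F'.onV (Sum.inl v) :=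
      congrFun (congrArg Hom.onV (hj.trans hj'.symm)) v
    exact (F.map_t (Sum.inr (⟨e, .start v e he hnew⟩, true))).trans
      (h1.trans (F'.map_t (Sum.inr (⟨e, .start v e he hnew⟩, true))).symm)
  | @step e w e' he' hne ih =>
    refine hγ.lift_unique ?_ (hE _)
    have h1 : F.onV (Sum.inr ⟨e, w⟩) = F'.onV (Sum.inr ⟨e, w⟩) :=
      (F.map_h (Sum.inr (⟨e, w⟩, true))).symm.trans
        ((congrArg G.h ih).trans (F'.map_h (Sum.inr (⟨e, w⟩, true))))
    exact (F.map_t (Sum.inr (⟨e', .step w e' he' hne⟩, true))).trans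
      (h1.trans (F'.map_t (Sum.inr (⟨e', .step w e' he' hne⟩, true))).symm)

theorem treeLift_proj (hγ : γ.IsCovering) {j : ψ.Hom G} (hj : γ.comp j = π) :
    γ.comp (treeLift hγ hj) = treeProj π := by
  apply Hom.ext
  · funext x
    rcases x with v | ⟨e, w⟩
    · exact congrFun (congrArg Hom.onV hj) v
    · change γ.onV (G.h (liftBranch hγ hj w).1) = B.h e
      rw [← γ.map_h, (liftBranch hγ hj w).2]
  · funext x
    rcases x with e | ⟨⟨e, w⟩, _ | _⟩
    · exact congrFun (congrArg Hom.onE hj) e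
    · change γ.onE (G.inv (liftBranch hγ hj w).1) = B.inv e
      rw [γ.map_inv, (liftBranch hγ hj w).2]
    · exact (liftBranch hγ hj w).2

/-- The universal property of the relative tree: every morphism of `B`-graphs from `ψ` to a covering
`B`-graph `G` (in particular, every inclusion of `ψ` in `G`) extends uniquely to a morphism of
`B`-graphs from the relative tree to `G`. -/
theorem relTree_universal (hγ : γ.IsCovering) (j : ψ.Hom G) (hj : γ.comp j = π) :
    ∃! F : (relTree π).Hom G, γ.comp F = treeProj π ∧ F.comp (treeIncl π) = j := by
  refine ⟨treeLift hγ hj, ⟨treeLift_proj hγ hj, rfl⟩, ?_⟩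
  · rintro F ⟨hF, hFj⟩
    have key : ∀ {e : B.E} (w : Branch π e), F.onE (Sum.inr (⟨e, w⟩, true)) =
        (treeLift hγ hj).onE (Sum.inr (⟨e, w⟩, true)) := fun w =>
      treeLift_unique_aux hγ hF (treeLift_proj hγ hj) hFj rfl w
    apply Hom.ext
    · funext x
      rcases x with v | ⟨e, w⟩
      · exact congrFun (congrArg Hom.onV hFj) v
      · exact (F.map_h (Sum.inr (⟨e, w⟩, true))).symm.trans
          ((congrArg G.h (key w)).trans ((treeLift hγ hj).map_h (Sum.inr (⟨e, w⟩, true))))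
    · funext x
      rcases x with e | ⟨⟨e, w⟩, _ | _⟩
      · exact congrFun (congrArg Hom.onE hFj) e
      · exact (F.map_inv (Sum.inr (⟨e, w⟩, true))).trans ((congrArg G.inv (key w)).trans
          ((treeLift hγ hj).map_inv (Sum.inr (⟨e, w⟩, true))).symm)
      · exact key w

end RelTree

end InvGraph

/-! A positive square-summable eigenfunction of a symmetric non-negative matrix determines its norm:
the Schur test bounds the norm above by the eigenvalue, and the eigenfunction attains the bound
(`exists_lp_operator_norm_eq_of_pos_eigenvector`). Such a function `p` on the tree is built from the
Hashimoto matrix.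

Let `μ = ψ.mu₁`, let `g ≥ 0` be an eigenvector of the Hashimoto matrix for `μ`, and let `F v` be the
sum of `g` over the edges leaving `v`. Comparing the eigenvalue equations at `e` and at its inverse
gives `F (h e) - μ⁻¹ F (t e) = (μ - μ⁻¹) g e`. Summed over the edges leaving `v`, this becomes a
vertex equation in `F` alone (`exists_pos_ihara_solution`).

Extend `F` to `p` by multiplying by `μ⁻¹` along each new edge. A new edge, read away from `ψ`,
contributes zero to the vertex equation, so the equation persists on the whole tree
(`sum_treeWeight_sub`). The tree covers `B`, hence is `d`-regular, and the equation turns into `A p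
= (μ + (d - 1)/μ) p`.

Past the first generation, each new vertex has `d - 1` children, each with `μ⁻²` times its squared
weight. So `p` is in `L²` once `(d - 1)/μ² < 1`, which is the hypothesis on `μ`
(`summable_treeWeight_sq`). -/

/-! ### Weak Perron-Frobenius theorem -/

section PerronFrobenius

open Matrix Filter Topology

variable {n : Type*} [Fintype n]

theorem Matrix.mulVec_mono_of_nonneg {M : Matrix n n ℝ} (hM : ∀ i j, 0 ≤ M i j) {x y : n → ℝ}
    (hxy : x ≤ y) : M *ᵥ x ≤ M *ᵥ y := fun i =>
  Finset.sum_le_sum fun j _ => mul_le_mul_of_nonneg_left (hxy j) (hM i j)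

variable [DecidableEq n]

theorem Matrix.exists_mulVec_eq_smul_norm_eq_spectralRadius [Nonempty n] (M : Matrix n n ℂ) :
    ∃ (k : ℂ) (x : n → ℂ), x ≠ 0 ∧ M *ᵥ x = k • x ∧ ‖k‖ = (spectralRadius ℂ M).toReal := by
  -- The norm is auxiliary; `spectralRadius` does not depend on it.
  let _ : NormedRing (Matrix n n ℂ) := Matrix.linftyOpNormedRing
  let _ : NormedAlgebra ℂ (Matrix n n ℂ) := Matrix.linftyOpNormedAlgebra
  obtain ⟨k, hk, hk'⟩ := spectrum.exists_nnnorm_eq_spectralRadius M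
  rw [← Matrix.spectrum_toLin'] at hk
  obtain ⟨x, hx⟩ := (Module.End.hasEigenvalue_iff_mem_spectrum.2 hk).exists_hasEigenvector
  refine ⟨k, x, hx.2, ?_, ?_⟩
  · simpa using hx.apply_eq_smul
  · rw [← hk']; simp

/-- Gelfand's formula: for `q` strictly between the spectral radius and `t`, eventually `‖M ^ N‖ ≤ q
^ N`, so the quotient is at most a multiple of `(q / t) ^ N`. -/
theorem Matrix.tendsto_pow_mulVec_div_pow (M : Matrix n n ℂ) (x : n → ℂ) {t : ℝ}
    (ht : (spectralRadius ℂ M).toReal < t) :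
    Tendsto (fun N : ℕ => ‖(M ^ N) *ᵥ x‖ / t ^ N) atTop (𝓝 0) := by
  let _ : NormedRing (Matrix n n ℂ) := Matrix.linftyOpNormedRing
  let _ : NormedAlgebra ℂ (Matrix n n ℂ) := Matrix.linftyOpNormedAlgebra
  have hfin : spectralRadius ℂ M ≠ ⊤ := by
    rcases isEmpty_or_nonempty n with h | h
    · rw [spectrum.SpectralRadius.of_subsingleton]; exact ENNReal.zero_ne_top
    · obtain ⟨k, -, hk⟩ := spectrum.exists_nnnorm_eq_spectralRadius M
      rw [← hk]; exact ENNReal.coe_ne_top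
  obtain ⟨q, hq, hqt⟩ := exists_between ht
  have hq0 : 0 < q := ENNReal.toReal_nonneg.trans_lt hq
  have ht0 : 0 < t := hq0.trans hqt
  have hlim := spectrum.pow_norm_pow_one_div_tendsto_nhds_spectralRadius M
  have hlt : spectralRadius ℂ M < ENNReal.ofReal q := (ENNReal.lt_ofReal_iff_toReal_lt hfin).2 hq
  have hev : ∀ᶠ N : ℕ in atTop, ‖M ^ N‖ ≤ q ^ N := by
    filter_upwards [hlim.eventually (gt_mem_nhds hlt), eventually_gt_atTop 0] with N hN hN0
    have h1 : ‖M ^ N‖ ^ (1 / N : ℝ) < q := (ENNReal.ofReal_lt_ofReal_iff hq0).1 hN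
    have h2 := pow_le_pow_left₀ (by positivity) h1.le N
    rwa [one_div, Real.rpow_inv_natCast_pow (norm_nonneg _) hN0.ne'] at h2
  have hgeo : Tendsto (fun N : ℕ => (q / t) ^ N * ‖x‖) atTop (𝓝 0) := by
    have := (tendsto_pow_atTop_nhds_zero_of_lt_one (by positivity)
      ((div_lt_one ht0).2 hqt)).mul_const ‖x‖
    simpa using this
  refine squeeze_zero' (Eventually.of_forall fun N => by positivity) ?_ hgeo
  filter_upwards [hev] with N hN
  rw [div_pow, div_mul_eq_mul_div]
  gcongr
  exact (Matrix.linfty_opNorm_mulVec _ _).trans (by gcongr)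

/-- The sum is a truncated Neumann series for `(t - M)⁻¹ x`; the product telescopes. Truncation
avoids inverting `t - M` and leaves an explicit error. -/
theorem Matrix.pow_succ_mulVec_sub {R : Type*} [Field R] (M : Matrix n n R) (x : n → R) {t : R}
    (ht : t ≠ 0) (N : ℕ) :
    t • (∑ k ∈ Finset.range N, (t ^ (k + 1))⁻¹ • ((M ^ k) *ᵥ x)) -
      M *ᵥ (∑ k ∈ Finset.range N, (t ^ (k + 1))⁻¹ • ((M ^ k) *ᵥ x)) =
      x - (t ^ N)⁻¹ • ((M ^ N) *ᵥ x) := by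
  induction N with
  | zero => simp
  | succ N ih =>
    rw [Finset.sum_range_succ, smul_add, Matrix.mulVec_add, add_sub_add_comm, ih,
      Matrix.mulVec_smul, Matrix.mulVec_mulVec, ← pow_succ', smul_smul]
    have : t * (t ^ (N + 1))⁻¹ = (t ^ N)⁻¹ := by
      rw [pow_succ']; field_simp
    rw [this]
    abel

theorem Matrix.pow_smul_le_pow_mulVec {M : Matrix n n ℝ} (hM : ∀ i j, 0 ≤ M i j) {x : n → ℝ}
    {r : ℝ} (hr : 0 ≤ r) (hx : r • x ≤ M *ᵥ x) (k : ℕ) : r ^ k • x ≤ (M ^ k) *ᵥ x := by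
  induction k with
  | zero => simp
  | succ k ih =>
    calc r ^ (k + 1) • x = r ^ k • (r • x) := by rw [smul_smul, pow_succ]
      _ ≤ r ^ k • (M *ᵥ x) := smul_le_smul_of_nonneg_left hx (pow_nonneg hr k)
      _ = M *ᵥ (r ^ k • x) := (Matrix.mulVec_smul _ _ _).symm
      _ ≤ M *ᵥ ((M ^ k) *ᵥ x) := Matrix.mulVec_mono_of_nonneg hM ih
      _ = (M ^ (k + 1)) *ᵥ x := by rw [Matrix.mulVec_mulVec, pow_succ']

/-- The weak Perron-Frobenius theorem: the spectral radius of a non-negative matrix is an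
eigenvalue with a non-negative eigenvector. -/
theorem Matrix.exists_nonneg_eigenvector [Nonempty n] {M : Matrix n n ℝ}
    (hM : ∀ i j, 0 ≤ M i j) {r : ℝ} (hr : r = (spectralRadius ℂ (M.map Complex.ofReal)).toReal)
    (hr0 : 0 < r) : ∃ z : n → ℝ, 0 ≤ z ∧ z ≠ 0 ∧ M *ᵥ z = r • z := by
  obtain ⟨k, w, hw0, hw, hk⟩ :=
    Matrix.exists_mulVec_eq_smul_norm_eq_spectralRadius (M.map Complex.ofReal)
  rw [← hr] at hk
  set x : n → ℝ := fun i => ‖w i‖ with hxdef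
  have hx0 : 0 ≤ x := fun i => norm_nonneg _
  have hxne : x ≠ 0 := fun h => hw0 (funext fun i => norm_eq_zero.1 (congrFun h i))
  have hxpos : 0 < ‖x‖ := norm_pos_iff.2 hxne
  -- Triangle inequality in the complex eigenvalue equation: the absolute values form a subinvariant
  -- vector.
  have hx : r • x ≤ M *ᵥ x := by
    intro i
    have h1 : ‖(M.map Complex.ofReal *ᵥ w) i‖ = r * x i := by rw [hw]; simp [hk, hxdef]
    rw [Pi.smul_apply, smul_eq_mul, ← h1]
    refine (norm_sum_le _ _).trans (Finset.sum_le_sum fun j _ => ?_)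
    simp [hxdef, abs_of_nonneg (hM i j)]
  -- The truncated resolvent at `r + ε`, applied to `x`, has size at least of order `1 / ε` while
  -- its residual stays bounded; after normalisation it is an approximate eigenvector.
  have approx : ∀ ε : ℝ, 0 < ε → ∃ y : n → ℝ, (2 * ε)⁻¹ • x ≤ y ∧
      ‖(r + ε) • y - M *ᵥ y‖ ≤ ‖x‖ + 1 := by
    intro ε hε
    set t := r + ε with ht
    have ht0 : 0 < t := by positivity
    have hrt : r < t := by linarith
    have h1 := Matrix.tendsto_pow_mulVec_div_pow (M.map Complex.ofReal) (Complex.ofReal ∘ x)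
      (t := t) (by rw [← hr]; exact hrt)
    have h2 : Tendsto (fun N : ℕ => (r / t) ^ N) atTop (𝓝 0) :=
      tendsto_pow_atTop_nhds_zero_of_lt_one (by positivity) ((div_lt_one ht0).2 hrt)
    -- `N` is so large that the Neumann error is below `1` and the geometric series reaches half of
    -- its limit `1 / ε`, whence the factor `(2 * ε)⁻¹`.
    obtain ⟨N, hN1, hN2⟩ := ((h1.eventually (gt_mem_nhds one_pos)).and
      (h2.eventually (gt_mem_nhds (half_pos one_pos)))).exists
    refine ⟨∑ k ∈ Finset.range N, (t ^ (k + 1))⁻¹ • ((M ^ k) *ᵥ x), ?_, ?_⟩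
    · have h3 : ∑ k ∈ Finset.range N, (t ^ (k + 1))⁻¹ • (r ^ k • x) ≤
          ∑ k ∈ Finset.range N, (t ^ (k + 1))⁻¹ • ((M ^ k) *ᵥ x) :=
        Finset.sum_le_sum fun k _ => smul_le_smul_of_nonneg_left
          (Matrix.pow_smul_le_pow_mulVec hM hr0.le hx k) (by positivity)
      refine le_trans ?_ h3
      simp_rw [smul_smul]
      rw [← Finset.sum_smul]
      refine smul_le_smul_of_nonneg_right ?_ hx0
      have h4 : ∑ k ∈ Finset.range N, (t ^ (k + 1))⁻¹ * r ^ k = (1 - (r / t) ^ N) / ε := by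
        have h5 : ∀ k ∈ Finset.range N, (t ^ (k + 1))⁻¹ * r ^ k = t⁻¹ * (r / t) ^ k := by
          intro k _
          rw [div_pow, pow_succ']; field_simp
        rw [Finset.sum_congr rfl h5, ← Finset.mul_sum,
          geom_sum_eq ((div_lt_one ht0).2 hrt).ne]
        have h6 : r / t - 1 = -(ε / t) := by rw [ht]; field_simp; ring
        rw [h6]
        field_simp
        ring
      rw [h4, mul_inv, ← div_eq_mul_inv]
      gcongr
      linarith
    · rw [Matrix.pow_succ_mulVec_sub M x ht0.ne' N]
      refine (norm_sub_le _ _).trans (add_le_add le_rfl ?_)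
      have h3 : (M.map Complex.ofReal ^ N) *ᵥ (Complex.ofReal ∘ x) =
          Complex.ofReal ∘ ((M ^ N) *ᵥ x) := by
        have h4 : M.map Complex.ofReal ^ N = (M ^ N).map Complex.ofReal :=
          (map_pow (Complex.ofRealHom.mapMatrix) M N).symm
        rw [h4]
        funext i
        exact (RingHom.map_mulVec Complex.ofRealHom (M ^ N) x i).symm
      have h5 : ‖Complex.ofReal ∘ ((M ^ N) *ᵥ x)‖ = ‖(M ^ N) *ᵥ x‖ := by
        simp [Pi.norm_def]
      rw [h3, h5] at hN1
      rw [norm_smul, norm_inv, norm_pow, Real.norm_of_nonneg ht0.le, inv_mul_eq_div]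
      exact hN1.le
  let K : Set (n → ℝ) := Metric.sphere 0 1 ∩ Set.Ici 0
  have hK : IsCompact K := (isCompact_sphere 0 1).inter_right isClosed_Ici
  have small : ∀ ε : ℝ, 0 < ε → ∃ z ∈ K, ‖r • z - M *ᵥ z‖ ≤ ε * (1 + 2 * (‖x‖ + 1) / ‖x‖) := by
    intro ε hε
    obtain ⟨y, hxy, hy⟩ := approx ε hε
    have hy0 : 0 ≤ y := le_trans (smul_nonneg (by positivity) hx0) hxy
    have hny : (2 * ε)⁻¹ * ‖x‖ ≤ ‖y‖ := by
      have h1 : ‖(2 * ε)⁻¹ • x‖ ≤ ‖y‖ := by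
        refine (pi_norm_le_iff_of_nonneg (norm_nonneg _)).2 fun i => ?_
        have h2 : 0 ≤ ((2 * ε)⁻¹ • x) i := smul_nonneg (by positivity : (0 : ℝ) ≤ _) (hx0 i)
        rw [Real.norm_of_nonneg h2]
        exact (hxy i).trans ((Real.le_norm_self _).trans (norm_le_pi_norm y i))
      rwa [norm_smul, norm_inv, Real.norm_of_nonneg (by positivity)] at h1
    have hypos : 0 < ‖y‖ := lt_of_lt_of_le (by positivity) hny
    refine ⟨‖y‖⁻¹ • y, ⟨?_, smul_nonneg (by positivity) hy0⟩, ?_⟩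
    · simp [norm_smul, hypos.ne']
    · have h1 : r • (‖y‖⁻¹ • y) - M *ᵥ (‖y‖⁻¹ • y) =
          ‖y‖⁻¹ • (((r + ε) • y - M *ᵥ y) - ε • y) := by
        rw [Matrix.mulVec_smul, smul_comm r, ← smul_sub, add_smul]
        congr 1; abel
      rw [h1, norm_smul, norm_inv, norm_norm]
      have h2 : ‖((r + ε) • y - M *ᵥ y) - ε • y‖ ≤ (‖x‖ + 1) + ε * ‖y‖ := by
        refine (norm_sub_le _ _).trans (add_le_add hy ?_)
        rw [norm_smul, Real.norm_of_nonneg hε.le]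
      rw [inv_mul_le_iff₀ hypos]
      refine h2.trans ?_
      have h3 : ‖x‖ ≤ ‖y‖ * (2 * ε) := by
        rw [inv_mul_eq_div, div_le_iff₀ (by positivity)] at hny
        exact hny
      have h4 : ‖x‖ + 1 ≤ ‖y‖ * (ε * (2 * (‖x‖ + 1) / ‖x‖)) := by
        have h5 : ‖y‖ * (ε * (2 * (‖x‖ + 1) / ‖x‖)) = (‖y‖ * (2 * ε)) * (‖x‖ + 1) / ‖x‖ := by ring
        rw [h5, le_div_iff₀ hxpos]
        nlinarith
      nlinarith
  -- The residual is continuous on the compact set of non-negative unit vectors and takes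
  -- arbitrarily small values there, so its minimum is zero.
  have hKne : K.Nonempty := let ⟨z, hz, _⟩ := small 1 one_pos; ⟨z, hz⟩
  have hcont : Continuous fun z : n → ℝ => ‖r • z - M *ᵥ z‖ :=
    ((continuous_id.const_smul r).sub
      (Continuous.matrix_mulVec (A := fun _ => M) continuous_const continuous_id)).norm
  obtain ⟨z, hz, hmin⟩ := hK.exists_isMinOn hKne hcont.continuousOn
  have hC : 0 < 1 + 2 * (‖x‖ + 1) / ‖x‖ := by positivity
  have hzero : ‖r • z - M *ᵥ z‖ ≤ 0 := by
    refine le_of_forall_pos_le_add fun ε hε => ?_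
    obtain ⟨y, hy, hy'⟩ := small (ε / (1 + 2 * (‖x‖ + 1) / ‖x‖)) (by positivity)
    rw [div_mul_cancel₀ _ hC.ne'] at hy'
    rw [zero_add]
    exact (hmin hy).trans hy'
  refine ⟨z, hz.2, fun h => ?_, (sub_eq_zero.1 (norm_le_zero_iff.1 hzero)).symm⟩
  have h1 := hz.1
  rw [h] at h1
  simp at h1

end PerronFrobenius

/-! ### Schur test and attainment of the norm -/

section Schur

open Filter Topology

variable {ι : Type*}

/-- The Schur test for a symmetric non-negative matrix with a positive eigenvector. -/
theorem exists_lp_operator_of_pos_eigenvector {a : ι → ι → ℝ} (ha : ∀ v w, 0 ≤ a v w)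
    (hsymm : ∀ v w, a v w = a w v) {p : ι → ℝ} (hp : ∀ v, 0 < p v) {c : ℝ} (hc : 0 ≤ c)
    (hsum : ∀ v, HasSum (fun w => a v w * p w) (c * p v)) :
    ∃ A : lp (fun _ : ι => ℝ) 2 →L[ℝ] lp (fun _ : ι => ℝ) 2,
      (∀ (f : lp (fun _ : ι => ℝ) 2) (v : ι), HasSum (fun w => a v w * f w) (A f v)) ∧
        ‖A‖ ≤ c := by
  have hsq : ∀ f : lp (fun _ : ι => ℝ) 2, HasSum (fun w => f w ^ 2) (‖f‖ ^ 2) := fun f => by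
    simpa using lp.hasSum_norm (p := 2) (by norm_num) f
  have hle : ∀ v w, a v w * p v ≤ c * p w := fun v w => by
    rw [hsymm]
    exact le_hasSum (hsum w) v fun j _ => mul_nonneg (ha _ _) (hp j).le
  have hS : ∀ (f : lp (fun _ : ι => ℝ) 2) (v : ι), Summable fun w => a v w * (f w ^ 2 / p w) := by
    intro f v
    refine Summable.of_nonneg_of_le (fun w => ?_) (fun w => ?_) ((hsq f).summable.mul_left (c / p v))
    · exact mul_nonneg (ha v w) (div_nonneg (sq_nonneg _) (hp w).le)
    · have h1 : a v w ≤ c * p w / p v := (le_div_iff₀ (hp v)).2 (hle v w)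
      calc a v w * (f w ^ 2 / p w) ≤ c * p w / p v * (f w ^ 2 / p w) :=
            mul_le_mul_of_nonneg_right h1 (div_nonneg (sq_nonneg _) (hp w).le)
        _ = c / p v * f w ^ 2 := by
            have := (hp w).ne'
            have := (hp v).ne'
            field_simp
  have hA : ∀ (f : lp (fun _ : ι => ℝ) 2) (v : ι), Summable fun w => a v w * f w := by
    intro f v
    refine Summable.of_norm_bounded ((hsum v).summable.add (hS f v)) fun w => ?_
    rw [norm_mul, Real.norm_of_nonneg (ha v w), ← mul_add]
    refine mul_le_mul_of_nonneg_left ?_ (ha v w)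
    rw [Real.norm_eq_abs, ← sub_nonneg]
    -- Completing the square gives `|f| ≤ p + f² / p`, so the row sum is dominated by two convergent
    -- ones.
    have h1 : p w + f w ^ 2 / p w - |f w| =
        ((p w - |f w| / 2) ^ 2 + 3 / 4 * |f w| ^ 2) / p w := by
      have := (hp w).ne'
      field_simp
      rw [← sq_abs (f w)]
      ring
    rw [h1]
    have := hp w
    positivity
  -- Cauchy-Schwarz with the splitting `a f = √(a p) · √(a f² / p)`, on finite partial sums and then
  -- in the limit.
  have hCS : ∀ (f : lp (fun _ : ι => ℝ) 2) (v : ι),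
      (∑' w, a v w * f w) ^ 2 ≤ c * (p v * ∑' w, a v w * (f w ^ 2 / p w)) := by
    intro f v
    rw [← mul_assoc]
    refine le_of_tendsto_of_tendsto' ((hA f v).hasSum.pow 2)
      (Tendsto.mul (hsum v) (hS f v).hasSum) fun s => ?_
    refine Finset.sum_sq_le_sum_mul_sum_of_sq_le_mul s (fun w _ => mul_nonneg (ha v w) (hp w).le)
      (fun w _ => mul_nonneg (ha v w) (div_nonneg (sq_nonneg _) (hp w).le)) fun w _ => ?_
    have := (hp w).ne'
    refine le_of_eq ?_
    field_simp
  have hbound : ∀ (f : lp (fun _ : ι => ℝ) 2) (s : Finset ι),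
      ∑ v ∈ s, (∑' w, a v w * f w) ^ 2 ≤ (c * ‖f‖) ^ 2 := by
    intro f s
    have h1 : ∑ v ∈ s, (p v * ∑' w, a v w * (f w ^ 2 / p w)) ≤ c * ‖f‖ ^ 2 := by
      have h2 : HasSum (fun w => ∑ v ∈ s, p v * (a v w * (f w ^ 2 / p w)))
          (∑ v ∈ s, (p v * ∑' w, a v w * (f w ^ 2 / p w))) :=
        hasSum_sum fun v _ => (hS f v).hasSum.mul_left (p v)
      refine hasSum_le (fun w => ?_) h2 ((hsq f).mul_left c)
      -- After exchanging the sums, symmetry turns the column sum into a row sum, and the eigenvalue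
      -- equation applies a second time.
      have h3 : ∑ v ∈ s, a w v * p v ≤ c * p w :=
        sum_le_hasSum s (fun v _ => mul_nonneg (ha w v) (hp v).le) (hsum w)
      calc ∑ v ∈ s, p v * (a v w * (f w ^ 2 / p w))
          = (∑ v ∈ s, a w v * p v) * (f w ^ 2 / p w) := by
            rw [Finset.sum_mul]
            exact Finset.sum_congr rfl fun v _ => by rw [hsymm v w]; ring
        _ ≤ c * p w * (f w ^ 2 / p w) :=
            mul_le_mul_of_nonneg_right h3 (div_nonneg (sq_nonneg _) (hp w).le)
        _ = c * f w ^ 2 := by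
            have := (hp w).ne'
            field_simp
    calc ∑ v ∈ s, (∑' w, a v w * f w) ^ 2
        ≤ ∑ v ∈ s, c * (p v * ∑' w, a v w * (f w ^ 2 / p w)) :=
          Finset.sum_le_sum fun v _ => hCS f v
      _ = c * ∑ v ∈ s, (p v * ∑' w, a v w * (f w ^ 2 / p w)) := by rw [Finset.mul_sum]
      _ ≤ c * (c * ‖f‖ ^ 2) := mul_le_mul_of_nonneg_left h1 hc
      _ = (c * ‖f‖) ^ 2 := by ring
  have hmem : ∀ f : lp (fun _ : ι => ℝ) 2, Memℓp (fun v => ∑' w, a v w * f w) 2 := fun f =>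
    memℓp_gen' (C := (c * ‖f‖) ^ 2) fun s => by simpa using hbound f s
  let L : lp (fun _ : ι => ℝ) 2 →ₗ[ℝ] lp (fun _ : ι => ℝ) 2 :=
    { toFun := fun f => ⟨fun v => ∑' w, a v w * f w, hmem f⟩
      map_add' := fun f g => by
        ext v
        change ∑' w, a v w * (f w + g w) = (∑' w, a v w * f w) + ∑' w, a v w * g w
        rw [← (hA f v).tsum_add (hA g v)]
        exact tsum_congr fun w => mul_add _ _ _
      map_smul' := fun r f => by
        ext v
        change ∑' w, a v w * (r * f w) = r * ∑' w, a v w * f w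
        rw [← tsum_mul_left]
        exact tsum_congr fun w => by ring }
  have hL : ∀ f, ‖L f‖ ≤ c * ‖f‖ := fun f =>
    lp.norm_le_of_forall_sum_le (by norm_num) (by positivity) fun s => by
      have h1 := hbound f s
      simpa [L] using h1
  exact ⟨L.mkContinuous c hL, fun f v => (hA f v).hasSum, L.mkContinuous_norm_le hc hL⟩

/-- Square-summability makes `p` itself a nonzero eigenvector in `ℓ²`, so the Schur bound is
attained. -/
theorem exists_lp_operator_norm_eq_of_pos_eigenvector [Nonempty ι] {a : ι → ι → ℝ}
    (ha : ∀ v w, 0 ≤ a v w) (hsymm : ∀ v w, a v w = a w v) {p : ι → ℝ} (hp : ∀ v, 0 < p v)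
    {c : ℝ} (hc : 0 ≤ c) (hsum : ∀ v, HasSum (fun w => a v w * p w) (c * p v))
    (hp2 : Summable fun v => p v ^ 2) :
    ∃ A : lp (fun _ : ι => ℝ) 2 →L[ℝ] lp (fun _ : ι => ℝ) 2,
      (∀ (f : lp (fun _ : ι => ℝ) 2) (v : ι), HasSum (fun w => a v w * f w) (A f v)) ∧
        ‖A‖ = c := by
  obtain ⟨A, hA, hAc⟩ := exists_lp_operator_of_pos_eigenvector ha hsymm hp hc hsum
  refine ⟨A, hA, le_antisymm hAc ?_⟩
  let P : lp (fun _ : ι => ℝ) 2 := ⟨p, memℓp_gen (by simpa using hp2)⟩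
  have hP : P ≠ 0 := fun h => by
    obtain ⟨v⟩ := ‹Nonempty ι›
    have h1 : P v = 0 := by rw [h]; rfl
    exact (hp v).ne' h1
  have hAP : A P = c • P := by
    ext v
    exact (hA P v).unique (hsum v)
  have h1 := A.le_opNorm P
  rw [hAP, norm_smul, Real.norm_of_nonneg hc] at h1
  exact le_of_mul_le_mul_right h1 (norm_pos_iff.2 hP)

end Schur

/-! ### Adjacency sums and the vertex equation on `ψ` -/

namespace InvGraph

theorem adj_symm (G : InvGraph.{u₁, v₁}) (v w : G.V) : G.adj v w = G.adj w v :=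
  Nat.card_congr
    { toFun e := ⟨G.inv e.1, (G.t_inv _).trans e.2.2, (G.h_inv _).trans e.2.1⟩
      invFun e := ⟨G.inv e.1, (G.t_inv _).trans e.2.2, (G.h_inv _).trans e.2.1⟩
      left_inv _ := Subtype.ext (G.inv_inv _)
      right_inv _ := Subtype.ext (G.inv_inv _) }

/-- Grouping the finitely many edges at `v` by their heads replaces an infinite sum over vertices by
a finite sum over edges. -/
theorem hasSum_adj_mul (G : InvGraph.{u₁, v₁}) (v : G.V) [Fintype {e : G.E // G.t e = v}]
    (q : G.V → ℝ) :
    HasSum (fun w => (G.adj v w : ℝ) * q w) (∑ e : {e : G.E // G.t e = v}, q (G.h e)) := by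
  classical
  have hadj : ∀ w, G.adj v w =
      (Finset.univ.filter fun e : {e : G.E // G.t e = v} => G.h e.1 = w).card := by
    intro w
    rw [← Fintype.card_subtype, ← Nat.card_eq_fintype_card]
    exact Nat.card_congr
      (Equiv.subtypeSubtypeEquivSubtypeInter (fun e => G.t e = v) fun e => G.h e = w).symm
  have h1 : ∑ e : {e : G.E // G.t e = v}, q (G.h e) =
      ∑ w ∈ Finset.univ.image fun e : {e : G.E // G.t e = v} => G.h e.1,
        (G.adj v w : ℝ) * q w := by
    rw [← Finset.sum_fiberwise_of_maps_to
      (g := fun e : {e : G.E // G.t e = v} => G.h e.1)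
      (fun e he => Finset.mem_image_of_mem (fun e : {e : G.E // G.t e = v} => G.h e.1) he)]
    refine Finset.sum_congr rfl fun w _ => ?_
    rw [Finset.sum_congr rfl fun e he => congrArg q (Finset.mem_filter.1 he).2,
      Finset.sum_const, hadj, nsmul_eq_mul]
  rw [h1]
  refine hasSum_sum_of_ne_finset_zero fun w hw => ?_
  rw [hadj, Finset.card_eq_zero.2, Nat.cast_zero, zero_mul]
  refine Finset.filter_eq_empty_iff.2 fun e _ he => hw ?_
  exact Finset.mem_image.2 ⟨e, Finset.mem_univ _, he⟩

open Classical in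
/-- The non-backtracking walks that continue `e` are the edges leaving `h e`, except for the
reverse of `e`. -/
theorem sum_nonbacktracking (G : InvGraph.{u₁, v₁}) [Fintype G.E] (g : G.E → ℝ) (e : G.E) :
    ∑ e' : G.E, (if G.h e = G.t e' ∧ G.inv e ≠ e' then g e' else 0) =
      (∑ e' ∈ Finset.univ.filter fun e' => G.t e' = G.h e, g e') - g (G.inv e) := by
  have hmem : G.inv e ∈ Finset.univ.filter fun e' => G.t e' = G.h e := by simp [G.t_inv]
  rw [← Finset.sum_erase_eq_sub hmem, ← Finset.sum_filter]
  refine Finset.sum_congr ?_ fun _ _ => rfl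
  ext e'
  simp only [Finset.mem_filter, Finset.mem_univ, true_and, Finset.mem_erase]
  exact ⟨fun h => ⟨h.2.symm, h.1.symm⟩, fun h => ⟨h.2.symm, h.1.symm⟩⟩

open Classical in
theorem exists_nonneg_hashimoto_eigenvector (G : InvGraph.{u₁, v₁}) [Fintype G.E]
    [DecidableEq G.E] (hμ : 0 < G.mu₁) :
    ∃ g : G.E → ℝ, 0 ≤ g ∧ g ≠ 0 ∧ ∀ e,
      (∑ e' ∈ Finset.univ.filter fun e' => G.t e' = G.h e, g e') - g (G.inv e) =
        G.mu₁ * g e := by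
  have hne : Nonempty G.E := by
    by_contra h
    rw [not_nonempty_iff] at h
    rw [mu₁, spectrum.SpectralRadius.of_subsingleton] at hμ
    exact lt_irrefl _ hμ
  -- A real copy of the Hashimoto matrix: `mu₁` is a complex spectral radius, but the eigenvector
  -- must be non-negative.
  let M : Matrix G.E G.E ℝ :=
    Matrix.of fun e₁ e₂ => if G.h e₁ = G.t e₂ ∧ G.inv e₁ ≠ e₂ then 1 else 0
  have hM : M.map Complex.ofReal = G.hashimoto := by
    ext e₁ e₂
    simp only [M, hashimoto, Matrix.map_apply, Matrix.of_apply]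
    split_ifs <;> simp
  have hM0 : ∀ i j, 0 ≤ M i j := fun i j => by
    simp only [M, Matrix.of_apply]
    split_ifs <;> simp
  obtain ⟨g, hg0, hg, hgM⟩ :=
    Matrix.exists_nonneg_eigenvector hM0 (r := G.mu₁) (by rw [hM]; rfl) hμ
  refine ⟨g, hg0, hg, fun e => ?_⟩
  rw [← G.sum_nonbacktracking]
  refine Eq.trans (Finset.sum_congr rfl fun e' _ => ?_) (congrFun hgM e)
  simp [M]

/-- The Perron-Frobenius eigenvector of the Hashimoto matrix, summed over the edges leaving a
vertex, is a positive function on the vertices that solves the equation behind the Ihara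
determinantal formula. -/
theorem exists_pos_ihara_solution (G : InvGraph.{u₁, v₁}) [Fintype G.E] [DecidableEq G.E]
    (hconn : G.IsConnected) (hμ : 0 < G.mu₁) :
    ∃ F : G.V → ℝ, (∀ v, 0 < F v) ∧ ∀ (v : G.V) [Fintype {e : G.E // G.t e = v}],
      ∑ e : {e : G.E // G.t e = v}, (F (G.h e) - G.mu₁⁻¹ * F v) =
        (G.mu₁ - G.mu₁⁻¹) * F v := by
  classical
  obtain ⟨g, hg0, hg, hgH⟩ := G.exists_nonneg_hashimoto_eigenvector hμ
  set μ := G.mu₁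
  let F : G.V → ℝ := fun v => ∑ e ∈ Finset.univ.filter fun e => G.t e = v, g e
  have hF0 : ∀ v, 0 ≤ F v := fun v => Finset.sum_nonneg fun e _ => hg0 e
  -- The equations at `e` and at `G.inv e` eliminate `g (G.inv e)`. Half-loops need no separate
  -- case.
  have hedge : ∀ e, F (G.h e) - μ⁻¹ * F (G.t e) = (μ - μ⁻¹) * g e := by
    intro e
    have h1 : F (G.h e) - g (G.inv e) = μ * g e := hgH e
    have h2 : F (G.h (G.inv e)) - g (G.inv (G.inv e)) = μ * g (G.inv e) := hgH (G.inv e)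
    rw [G.h_inv, G.inv_inv] at h2
    have h3 : g (G.inv e) = μ⁻¹ * (F (G.t e) - g e) := by
      rw [h2, inv_mul_cancel_left₀ hμ.ne']
    linear_combination h1 + h3
  have hF : ∀ (v : G.V) [Fintype {e : G.E // G.t e = v}],
      ∑ e : {e : G.E // G.t e = v}, (F (G.h e) - μ⁻¹ * F v) = (μ - μ⁻¹) * F v := by
    intro v _
    have h1 : F v = ∑ e : {e : G.E // G.t e = v}, g e :=
      Finset.sum_subtype _ (fun e => by simp) g
    conv_rhs => rw [h1, Finset.mul_sum]
    refine Finset.sum_congr rfl fun e _ => ?_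
    rw [← hedge e.1, e.2]
  refine ⟨F, fun v => (hF0 v).lt_of_ne' fun hv => hg ?_, hF⟩
  -- At a zero of `F` the vertex equation says that non-negative terms sum to zero, so zeros spread
  -- to neighbours and, by connectedness, everywhere. Irreducibility of the Hashimoto matrix is not
  -- needed.
  have hstep : ∀ e, F (G.t e) = 0 → F (G.h e) = 0 := by
    intro e he
    have h1 := hF (G.t e)
    simp only [he, mul_zero, sub_zero] at h1
    exact (Finset.sum_eq_zero_iff_of_nonneg fun e' _ => hF0 _).1 h1 ⟨e, rfl⟩ (Finset.mem_univ _)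
  have hzero : ∀ w, F w = 0 := by
    intro w
    induction hconn.2 v w with
    | refl => exact hv
    | tail _ hab ih =>
      obtain ⟨e, rfl, rfl⟩ := hab
      exact hstep e ih
  funext e
  exact (Finset.sum_eq_zero_iff_of_nonneg fun e' _ => hg0 e').1 (hzero (G.t e)) e (by simp)

/-! ### The eigenfunction on the relative tree and its square-summability -/

section TreeWeight

variable {B : InvGraph.{u₂, v₂}} {ψ : InvGraph.{u₁, v₁}} {π : ψ.Hom B}

/-- The extension of a function on `ψ` to the branches of the relative tree that is multiplied by
`r` along each new edge. -/
def branchWeight (F : ψ.V → ℝ) (r : ℝ) : {e : B.E} → Branch π e → ℝ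
  | _, .start v _ _ _ => r * F v
  | _, .step w _ _ _ => r * branchWeight F r w

/-- The extension of a function on `ψ` to the relative tree that is multiplied by `r` along each
new edge. -/
def treeWeight (F : ψ.V → ℝ) (r : ℝ) : TreeVertex π → ℝ
  | .inl v => F v
  | .inr w => branchWeight F r w.2

theorem branchWeight_eq (F : ψ.V → ℝ) (r : ℝ) {e : B.E} (w : Branch π e) :
    branchWeight F r w = r * treeWeight F r w.parent := by
  cases w <;> rfl

theorem branchWeight_pos {F : ψ.V → ℝ} (hF : ∀ v, 0 < F v) {r : ℝ} (hr : 0 < r) {e : B.E}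
    (w : Branch π e) : 0 < branchWeight F r w := by
  induction w with
  | start v _ _ _ => exact mul_pos hr (hF v)
  | step w _ _ _ ih => exact mul_pos hr ih

theorem treeWeight_pos {F : ψ.V → ℝ} (hF : ∀ v, 0 < F v) {r : ℝ} (hr : 0 < r) :
    ∀ x : TreeVertex π, 0 < treeWeight F r x
  | .inl v => hF v
  | .inr w => branchWeight_pos hF hr w.2

/-- Edges to new children contribute zero. At a vertex of `ψ` this leaves the equation on `ψ`; at a
new vertex only the edge back to the parent remains, whose weight is `r⁻¹` times that of the vertex.
-/
theorem sum_treeWeight_sub {F : ψ.V → ℝ} {r : ℝ} (hr : r ≠ 0)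
    (hF : ∀ (v : ψ.V) [Fintype {e : ψ.E // ψ.t e = v}],
      ∑ e : {e : ψ.E // ψ.t e = v}, (F (ψ.h e) - r * F v) = (r⁻¹ - r) * F v)
    (x : (relTree π).V) [Fintype {e : (relTree π).E // (relTree π).t e = x}] :
    ∑ e : {e : (relTree π).E // (relTree π).t e = x},
      (treeWeight F r ((relTree π).h e) - r * treeWeight F r x) =
        (r⁻¹ - r) * treeWeight F r x := by
  rcases x with v | w
  · let i : {e : ψ.E // ψ.t e = v} → {e : (relTree π).E // (relTree π).t e = Sum.inl v} :=
      fun e => ⟨Sum.inl e.1, congrArg Sum.inl e.2⟩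
    have hi : Function.Injective i := fun e e' h =>
      Subtype.ext (Sum.inl.inj (congrArg Subtype.val h))
    have : Fintype {e : ψ.E // ψ.t e = v} := Fintype.ofInjective i hi
    refine Eq.trans ?_ (hF v)
    refine (Fintype.sum_of_injective i hi _ _ ?_ fun e => rfl).symm
    rintro ⟨e | ⟨w, _ | _⟩, he⟩ hne
    · exact absurd ⟨⟨e, Sum.inl.inj he⟩, rfl⟩ hne
    · exact absurd he (by simp [relTree])
    · have he' : w.2.parent = Sum.inl v := he
      change branchWeight F r w.2 - r * treeWeight F r (Sum.inl v) = 0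
      rw [branchWeight_eq, he', sub_self]
  · refine (Fintype.sum_eq_single ⟨Sum.inr (w, false), rfl⟩ ?_).trans ?_
    · rintro ⟨e | ⟨y, _ | _⟩, he⟩ hne
      · exact absurd he (by simp [relTree])
      · have he' : y = w := Sum.inr.inj he
        subst he'
        exact absurd rfl hne
      · have he' : y.2.parent = Sum.inr w := he
        change branchWeight F r y.2 - r * treeWeight F r (Sum.inr w) = 0
        rw [branchWeight_eq, he', sub_self]
    · change treeWeight F r w.2.parent - r * branchWeight F r w.2 =
        (r⁻¹ - r) * branchWeight F r w.2
      rw [sub_mul, branchWeight_eq, inv_mul_cancel_left₀ hr]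

theorem IsRegular.card_relTree {d : ℕ} (hB : B.IsRegular d) (hπ : π.IsEtale)
    (x : (relTree π).V) : Nat.card {e : (relTree π).E // (relTree π).t e = x} = d :=
  (Nat.card_congr ((treeProj_isCovering π hπ x).2.equiv _)).trans (hB _)

theorem hasSum_adj_mul_treeWeight {d : ℕ} (hd : 0 < d) (hB : B.IsRegular d) (hπ : π.IsEtale)
    {F : ψ.V → ℝ} {r : ℝ} (hr : r ≠ 0)
    (hF : ∀ (v : ψ.V) [Fintype {e : ψ.E // ψ.t e = v}],
      ∑ e : {e : ψ.E // ψ.t e = v}, (F (ψ.h e) - r * F v) = (r⁻¹ - r) * F v)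
    (x : (relTree π).V) :
    HasSum (fun y => ((relTree π).adj x y : ℝ) * treeWeight F r y)
      ((r⁻¹ + (d - 1) * r) * treeWeight F r x) := by
  have hcard := hB.card_relTree hπ x
  have : Finite {e : (relTree π).E // (relTree π).t e = x} :=
    Nat.finite_of_card_ne_zero (hcard.trans_ne hd.ne')
  have := Fintype.ofFinite {e : (relTree π).E // (relTree π).t e = x}
  convert (relTree π).hasSum_adj_mul x (treeWeight F r) using 1
  have h1 := sum_treeWeight_sub hr hF x
  rw [Finset.sum_sub_distrib, Finset.sum_const, Finset.card_univ, ← Nat.card_eq_fintype_card,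
    hcard, nsmul_eq_mul] at h1
  -- By regularity the subtracted terms total `d * r` times the weight at `x`, so the eigenvalue is
  -- `r⁻¹ - r + d * r`.
  linear_combination -h1

/-- The number of new edges between `ψ` and the parent of a new vertex. -/
def branchDepth : {e : B.E} → Branch π e → ℕ
  | _, .start _ _ _ _ => 0
  | _, .step w _ _ _ => branchDepth w + 1

-- One-generation recursion for the sum of squares. Truncation by depth keeps the sums boundable by
-- induction, and `ℝ≥0∞` removes summability obligations.
open ENNReal in
theorem tsum_branchWeight_le {d : ℕ} (hd : 0 < d) (hB : B.IsRegular d) (F : ψ.V → ℝ) (r : ℝ)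
    (N : ℕ) :
    ∑' w : (Σ e : B.E, Branch π e),
        (if branchDepth w.2 < N + 1 then ENNReal.ofReal (branchWeight F r w.2 ^ 2) else 0) ≤
      (d : ℝ≥0∞) * ∑' v, ENNReal.ofReal ((r * F v) ^ 2) +
        ENNReal.ofReal ((d - 1) * r ^ 2) * ∑' w : (Σ e : B.E, Branch π e),
          (if branchDepth w.2 < N then ENNReal.ofReal (branchWeight F r w.2 ^ 2) else 0) := by
  -- A branch is recorded by its parent and last edge. Dropping the condition `hnew` allows all `d`
  -- edges at each vertex of `ψ`, hence an inequality; a new vertex has exactly `d - 1`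
  -- continuations.
  let T := (Σ v : ψ.V, {e : B.E // B.t e = π.onV v}) ⊕
    (Σ w : (Σ e : B.E, Branch π e), {e : B.E // B.t e = B.h w.1 ∧ e ≠ B.inv w.1})
  let j : (Σ e : B.E, Branch π e) → T := fun w => match w with
    | ⟨e, .start v _ he _⟩ => .inl ⟨v, e, he⟩
    | ⟨e, .step w _ he hne⟩ => .inr ⟨⟨_, w⟩, e, he, hne⟩
  have hj : Function.Injective j := by
    rintro ⟨e, w | w⟩ ⟨e', w' | w'⟩ h
    · cases Sum.inl.inj h
      rfl
    · cases h
    · cases h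
    · cases Sum.inr.inj h
      rfl
  let K : T → ℝ≥0∞ := Sum.elim (fun x => ENNReal.ofReal ((r * F x.1) ^ 2))
    fun x => ENNReal.ofReal (r ^ 2) *
      (if branchDepth x.1.2 < N then ENNReal.ofReal (branchWeight F r x.1.2 ^ 2) else 0)
  have hK : ∀ w : (Σ e : B.E, Branch π e), (if branchDepth w.2 < N + 1 then
      ENNReal.ofReal (branchWeight F r w.2 ^ 2) else 0) = K (j w) := by
    rintro ⟨e, w | w⟩
    · simp [j, K, branchDepth, branchWeight]
    · simp only [j, K, branchDepth, branchWeight, Sum.elim_inr, Nat.add_lt_add_iff_right]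
      split_ifs
      · rw [mul_pow, ENNReal.ofReal_mul (sq_nonneg r)]
      · rw [mul_zero]
  have hfin : ∀ b : B.V, Finite {e : B.E // B.t e = b} := fun b =>
    Nat.finite_of_card_ne_zero ((hB b).trans_ne hd.ne')
  have hcard : ∀ w : (Σ e : B.E, Branch π e),
      (ENat.card {e : B.E // B.t e = B.h w.1 ∧ e ≠ B.inv w.1} : ℝ≥0∞) =
        ENNReal.ofReal (d - 1) := by
    intro w
    have hf : {e : B.E | B.t e = B.h w.1}.Finite := hfin (B.h w.1)
    have hset : {e : B.E | B.t e = B.h w.1 ∧ e ≠ B.inv w.1} =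
        {e : B.E | B.t e = B.h w.1} \ {B.inv w.1} := rfl
    have h1 : Nat.card {e : B.E // B.t e = B.h w.1 ∧ e ≠ B.inv w.1} = d - 1 := by
      rw [← hB (B.h w.1)]
      exact (congrArg Set.ncard hset).trans (Set.ncard_sdiff_singleton_of_mem (B.t_inv w.1))
    have : Finite {e : B.E // B.t e = B.h w.1 ∧ e ≠ B.inv w.1} := hf.sdiff
    rw [ENat.card_eq_coe_natCard, h1, ENat.toENNReal_coe, ← ENNReal.ofReal_natCast,
      Nat.cast_sub hd, Nat.cast_one]
  rw [tsum_congr hK]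
  refine (ENNReal.tsum_comp_le_tsum_of_injective hj K).trans (le_of_eq ?_)
  rw [ENNReal.summable.tsum_sum ENNReal.summable]
  congr 1
  · rw [ENNReal.tsum_sigma', ← ENNReal.tsum_mul_left]
    refine tsum_congr fun v => ?_
    have := hfin (π.onV v)
    simp only [K, Sum.elim_inl, ENNReal.tsum_const, ENat.card_eq_coe_natCard,
      ENat.toENNReal_coe]
    rw [hB]
  · rw [ENNReal.tsum_sigma', ← ENNReal.tsum_mul_left]
    refine tsum_congr fun w => ?_
    simp only [K, Sum.elim_inr, ENNReal.tsum_const, hcard]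
    rw [← mul_assoc, ENNReal.ofReal_mul' (sq_nonneg r)]

theorem summable_treeWeight_sq [Finite ψ.V] {d : ℕ} (hd : 0 < d) (hB : B.IsRegular d)
    (F : ψ.V → ℝ) {r : ℝ} (hr : ((d : ℝ) - 1) * r ^ 2 < 1) :
    Summable fun x : TreeVertex π => treeWeight F r x ^ 2 := by
  have := Fintype.ofFinite ψ.V
  have hd1 : (0 : ℝ) ≤ d - 1 := sub_nonneg.2 (Nat.one_le_cast.2 hd)
  set c : ℝ := (d - 1) * r ^ 2 with hc
  have hc0 : 0 ≤ c := mul_nonneg hd1 (sq_nonneg r)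
  set s : ℝ := d * ∑ v, (r * F v) ^ 2 with hs
  have hs0 : 0 ≤ s := mul_nonneg (Nat.cast_nonneg d) (Finset.sum_nonneg fun v _ => sq_nonneg _)
  have hC0 : 0 ≤ s / (1 - c) := div_nonneg hs0 (sub_nonneg.2 hr.le)
  -- `s / (1 - c)` is the fixed point of `x ↦ s + c * x`, so the recursion preserves this bound.
  have hbound : ∀ N : ℕ, ∑' w : (Σ e : B.E, Branch π e),
      (if branchDepth w.2 < N then ENNReal.ofReal (branchWeight F r w.2 ^ 2) else 0) ≤
        ENNReal.ofReal (s / (1 - c)) := by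
    intro N
    induction N with
    | zero => simp
    | succ N ih =>
      refine (tsum_branchWeight_le hd hB F r N).trans ?_
      have h1 : (d : ENNReal) * ∑' v, ENNReal.ofReal ((r * F v) ^ 2) = ENNReal.ofReal s := by
        rw [tsum_fintype, ← ENNReal.ofReal_sum_of_nonneg fun v _ => sq_nonneg _, hs,
          ENNReal.ofReal_mul (Nat.cast_nonneg d), ENNReal.ofReal_natCast]
      have h2 : s / (1 - c) = s + c * (s / (1 - c)) := by
        have : 1 - c ≠ 0 := (sub_pos.2 hr).ne'
        field_simp
        ring
      rw [h1, h2, ENNReal.ofReal_add hs0 (mul_nonneg hc0 hC0), ENNReal.ofReal_mul hc0]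
      gcongr
  have hbranch : Summable fun w : (Σ e : B.E, Branch π e) => branchWeight F r w.2 ^ 2 := by
    refine summable_of_sum_le (c := s / (1 - c)) (fun w => sq_nonneg _) fun u => ?_
    rw [← ENNReal.ofReal_le_ofReal_iff hC0, ENNReal.ofReal_sum_of_nonneg fun w _ => sq_nonneg _]
    -- A finite set of branches has bounded depth; the `+ 1` makes the cutoff strict.
    refine le_trans ?_ (hbound (u.sup (fun w => branchDepth w.2) + 1))
    refine le_trans (Finset.sum_le_sum fun w hw => ?_) (ENNReal.sum_le_tsum u)
    rw [if_pos (Nat.lt_succ_of_le (Finset.le_sup (f := fun w => branchDepth w.2) hw))]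
  exact (HasSum.sum (f := fun x : TreeVertex π => treeWeight F r x ^ 2)
    (hasSum_fintype fun v => F v ^ 2) hbranch.hasSum).summable

end TreeWeight

end InvGraph

/-! ### The norm of the adjacency operator -/

theorem mainTheorem6 (d : ℕ) (hd : 3 ≤ d)
    (B : InvGraph.{u₂, v₂}) (hB : B.IsRegular d)
    (ψ : InvGraph.{u₁, v₁}) [Finite ψ.V] [Fintype ψ.E] [DecidableEq ψ.E]
    (hconn : ψ.IsConnected) (π : ψ.Hom B) (hπ : π.IsEtale)
    (hμ : Real.sqrt ((d : ℝ) - 1) < ψ.mu₁) :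
    ∃ A : lp (fun _ : (InvGraph.relTree π).V => ℝ) 2 →L[ℝ]
        lp (fun _ : (InvGraph.relTree π).V => ℝ) 2,
      (InvGraph.relTree π).IsAdjacencyOperator A ∧
        ‖A‖ = ψ.mu₁ + ((d : ℝ) - 1) / ψ.mu₁ := by
  have hd0 : 0 < d := by omega
  have hd1 : (0 : ℝ) ≤ d - 1 := sub_nonneg.2 (Nat.one_le_cast.2 hd0)
  have hμ0 : 0 < ψ.mu₁ := (Real.sqrt_nonneg _).trans_lt hμ
  obtain ⟨F, hFpos, hF⟩ := ψ.exists_pos_ihara_solution hconn hμ0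
  have hr0 : 0 < ψ.mu₁⁻¹ := inv_pos.2 hμ0
  -- The bound on `mu₁`, squared, is precisely the convergence condition for the weight with ratio
  -- `r = ψ.mu₁⁻¹`.
  have hr : ((d : ℝ) - 1) * ψ.mu₁⁻¹ ^ 2 < 1 := by
    rw [inv_pow, ← div_eq_mul_inv, div_lt_one (by positivity)]
    exact (Real.sqrt_lt' hμ0).1 hμ
  have : Nonempty (InvGraph.relTree π).V := hconn.1.map Sum.inl
  have hsum := InvGraph.hasSum_adj_mul_treeWeight hd0 hB hπ hr0.ne'
    (fun v _ => by rw [inv_inv]; exact hF v)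
  rw [inv_inv] at hsum
  rw [div_eq_mul_inv]
  exact exists_lp_operator_norm_eq_of_pos_eigenvector (fun v w => Nat.cast_nonneg _)
    (fun v w => congrArg _ ((InvGraph.relTree π).adj_symm v w))
    (InvGraph.treeWeight_pos hFpos hr0) (by positivity) hsum
    (InvGraph.summable_treeWeight_sq hd0 hB F hr)
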